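/- Let $n\ge 0$ and let $f:\mathbb{Z}^n\to\mathbb{Z}\cup\{+\infty\}$ be an integer-valued multimodular function; that is, $\operatorname{dom} f=\{x\in\mathbb{Z}^n : f(x)<+\infty\}$ is nonempty and the function $$\tilde f(x_0,x_1,\dots,x_n)=f(x_1-x_0,\;x_2-x_1,\;\dots,\;x_n-x_{n-1})$$ on $\mathbb{Z}^{n+1}$ is submodular: $\tilde f(x)+\tilde f(y)\ge \tilde f(x\vee y)+\tilde f(x\wedge y)$ for all $x,y\in\mathbb{Z}^{n+1}$, where $\vee,\wedge$ are the componentwise maximum and minimum. Let $$f^{\bullet}(p)=\sup\{\langle p,x\rangle-f(x) : x\in\mathbb{Z}^n\}\qquad(p\in\mathbb{Z}^n)$$ be the integral conjugate of $f$, and let $D=(d_{ij})$ be the $n\times n$ bidiagonal matrix with $d_{ii}=1$ for $1\le i\le n$, $d_{i+1,i}=-1$ for $1\le i\le n-1$, and all other entries $0$. Then $D$ is unimodular, and there is an integer-valued M$^{\natural}$-convex function $h:\mathbb{Z}^n\to\mathbb{Z}\cup\{+\infty\}$ such that $$f^{\bullet}(p)=h(D^{\top}p)\qquad\text{for all } p\in\mathbb{Z}^n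 .$$ Here $h$ is M$^{\natural}$-convex if $\operatorname{dom} h\neq\emptyset$ and, for all $x,y\in\mathbb{Z}^n$ and every $i$ with $x_i>y_i$, either $h(x)+h(y)\ge h(x-e_i)+h(y+e_i)$, or there is some $j$ with $x_j<y_j$ and $h(x)+h(y)\ge h(x-e_i+e_j)+h(y+e_i-e_j)$, where $e_i$ denotes the $i$-th unit vector. -/

import Mathlib

namespace DiscreteConvex

open Matrix

/-- The effective domain of `f : ℤ^ι → ℤ ∪ {+∞}`. -/
def dom {ι : Type*} (f : (ι → ℤ) → WithTop ℤ) : Set (ι → ℤ) :=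
  {x | f x < ⊤}

/-- Submodularity on the integer lattice; `⊔`, `⊓` are the componentwise maximum and minimum. -/
def IsSubmodular {ι : Type*} (f : (ι → ℤ) → WithTop ℤ) : Prop :=
  ∀ x y : ι → ℤ, f (x ⊔ y) + f (x ⊓ y) ≤ f x + f y

/-- The function `(x₀, x₁, …, xₙ) ↦ f (x₁ - x₀, x₂ - x₁, …, xₙ - xₙ₋₁)` in `n + 1` variables. -/
def differenceLift {n : ℕ} (f : (Fin n → ℤ) → WithTop ℤ) : (Fin (n + 1) → ℤ) → WithTop ℤ :=
  fun x => f (fun i => x i.succ - x i.castSucc)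

/-- Multimodular functions with values in `ℤ ∪ {+∞}`. -/
def IsMultimodular {n : ℕ} (f : (Fin n → ℤ) → WithTop ℤ) : Prop :=
  (dom f).Nonempty ∧ IsSubmodular (differenceLift f)

/-- `M♮`-convex functions with values in `ℤ ∪ {+∞}`; `Pi.single i 1` is the `i`-th unit vector. -/
def IsMNaturalConvex {ι : Type*} [DecidableEq ι] (f : (ι → ℤ) → WithTop ℤ) : Prop :=
  (dom f).Nonempty ∧
    ∀ (x y : ι → ℤ) (i : ι), 0 < (x - y) i →
      f (x - Pi.single i 1) + f (y + Pi.single i 1) ≤ f x + f y ∨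
      ∃ j : ι, (x - y) j < 0 ∧
        f (x - Pi.single i 1 + Pi.single j 1) + f (y + Pi.single i 1 - Pi.single j 1) ≤ f x + f y

/-- The inclusion of `ℤ ∪ {+∞}` into the extended real line. -/
noncomputable def toEReal : WithTop ℤ → EReal
  | ⊤ => ⊤
  | (k : ℤ) => ((k : ℝ) : EReal)

/-- The integral conjugate `f•(p) = sup {⟨p, x⟩ - f x | x ∈ ℤ^ι}`, for `p ∈ ℤ^ι`. The supremum is
taken in the extended real line, where a term with `f x = +∞` is `-∞`. -/
noncomputable def integralConjugate {ι : Type*} [Fintype ι] (f : (ι → ℤ) → WithTop ℤ)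
    (p : ι → ℤ) : EReal :=
  ⨆ x : ι → ℤ, (((p ⬝ᵥ x : ℤ) : ℝ) : EReal) - toEReal (f x)

/-- The `n × n` bidiagonal matrix with `1` on the diagonal and `-1` just below it. -/
def bidiagonal (n : ℕ) : Matrix (Fin n) (Fin n) ℤ :=
  Matrix.of fun i j => if i = j then 1 else if (i : ℕ) = (j : ℕ) + 1 then -1 else 0

end DiscreteConvex

/-!
Write `F` for the lift of `f` to `n + 1` variables. It is submodular and invariant under adding
constant vectors, and `f•(p)` is the conjugate of `F` at `(-∑ qᵢ, q)` with `q = Dᵀ p`. So the function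
`h q = F•(-∑ qᵢ, q)` is the only candidate, and what has to be shown is that `F•` is `M`-convex on the
hyperplane of vectors with coordinate sum zero.

For the exchange axiom, let `A` and `B` be the sets of maximizers in the definitions of `F•(p)` and
`F•(q)`; they are closed under joins, meets and translation by constants. A unit step
`p ↦ p - e_u + e_v` raises `F•` by at most the maximum of `a v - a u` over `a ∈ A`
(`dotProduct_exchange_sub_le`), so an exchange `u, v` can only fail if some `a ∈ A`, `b ∈ B` with
`a u = b u = 0` satisfy `a v > b v`. If it fails for all `v` with `p v < q v`, joins in `A` and meets
in `B` produce one pair `a, b` that serves all these `v`. Submodularity at `a` and `b + 1` then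
gives `⟨p - q, (b + 1 - a)⁺⟩ ≤ 0`. But each term of this sum is nonnegative, and the term at `u` is
positive: a contradiction (`exists_exchange`).

That `F•` is finite somewhere means that `F` has an integral affine minorant. At a point of its domain,
moved to the origin, a slope `p` with coordinate sum zero is obtained on the unit cube by maximizing
`∑ pᵢ` subject to `⟨p, x⟩ ≤ F x - F 0` for all `x ∈ {0, 1}ⁿ⁺¹` (`exists_subgradient_unitCube`), and
submodularity extends the inequality to all integer points (`dotProduct_le_of_unitCube`).
-/

namespace DiscreteConvex

open Matrix

/-! ### Conjugates of integer-valued functions -/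

section Conjugate

variable {V : Type*} [Fintype V]

/-- The finite values `⟨p, x⟩ - f x` whose supremum is the conjugate of `f` at `p`. -/
def conjugateValues (f : (V → ℤ) → WithTop ℤ) (p : V → ℤ) : Set ℤ :=
  {k | ∃ (x : V → ℤ) (m : ℤ), f x = m ∧ p ⬝ᵥ x - m = k}

open Classical in
/-- The integral conjugate with values in `ℤ ∪ {+∞}`. It is the honest supremum when `dom f` is
nonempty; then a bounded set of values has a greatest element. -/
noncomputable def discreteConjugate (f : (V → ℤ) → WithTop ℤ) (p : V → ℤ) : WithTop ℤ :=
  if BddAbove (conjugateValues f p) then ((sSup (conjugateValues f p) : ℤ) : WithTop ℤ) else ⊤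

theorem conjugateValues_nonempty {f : (V → ℤ) → WithTop ℤ} (hf : (dom f).Nonempty) (p : V → ℤ) :
    (conjugateValues f p).Nonempty := by
  obtain ⟨x, hx⟩ := hf
  obtain ⟨m, hm⟩ := WithTop.ne_top_iff_exists.1 (ne_of_lt (show f x < ⊤ from hx))
  exact ⟨_, x, m, hm.symm, rfl⟩

theorem isGreatest_of_discreteConjugate_eq {f : (V → ℤ) → WithTop ℤ} (hf : (dom f).Nonempty)
    {p : V → ℤ} {m : ℤ} (h : discreteConjugate f p = m) : IsGreatest (conjugateValues f p) m := by
  unfold discreteConjugate at h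
  split_ifs at h with hb
  · obtain rfl := WithTop.coe_injective h
    exact ⟨Int.csSup_mem (conjugateValues_nonempty hf p) hb, fun k hk => le_csSup hb hk⟩
  · exact absurd h.symm (WithTop.coe_ne_top)

theorem discreteConjugate_le_iff {f : (V → ℤ) → WithTop ℤ} (hf : (dom f).Nonempty)
    {p : V → ℤ} {m : ℤ} :
    discreteConjugate f p ≤ m ↔ ∀ (x : V → ℤ) (k : ℤ), f x = k → p ⬝ᵥ x - k ≤ m := by
  constructor
  · intro h x k hx
    obtain ⟨l, hl⟩ := WithTop.ne_top_iff_exists.1 (ne_of_lt (lt_of_le_of_lt h (WithTop.coe_lt_top m)))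
    rw [← hl, WithTop.coe_le_coe] at h
    exact ((isGreatest_of_discreteConjugate_eq hf hl.symm).2 ⟨x, k, hx, rfl⟩).trans h
  · intro h
    have hub : m ∈ upperBounds (conjugateValues f p) := by
      rintro _ ⟨x, k, hx, rfl⟩
      exact h x k hx
    rw [discreteConjugate, if_pos ⟨m, hub⟩, WithTop.coe_le_coe]
    exact csSup_le (conjugateValues_nonempty hf p) hub

@[simp] theorem toEReal_top : toEReal ⊤ = ⊤ := rfl

@[simp] theorem toEReal_coe (k : ℤ) : toEReal (k : WithTop ℤ) = ((k : ℝ) : EReal) := rfl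

theorem integralConjugate_eq_toEReal {f : (V → ℤ) → WithTop ℤ} (hf : (dom f).Nonempty)
    (p : V → ℤ) : integralConjugate f p = toEReal (discreteConjugate f p) := by
  unfold integralConjugate
  by_cases htop : discreteConjugate f p = ⊤
  · rw [htop, toEReal_top, EReal.eq_top_iff_forall_lt]
    intro r
    have hnot : ¬ discreteConjugate f p ≤ ((⌈r⌉ : ℤ) : WithTop ℤ) := by simp [htop]
    rw [discreteConjugate_le_iff hf] at hnot
    push Not at hnot
    obtain ⟨x, k, hx, hk⟩ := hnot
    refine lt_of_lt_of_le ?_ (le_iSup _ x)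
    rw [hx, toEReal_coe, ← EReal.coe_sub, EReal.coe_lt_coe_iff]
    calc r ≤ (⌈r⌉ : ℝ) := Int.le_ceil r
      _ < ((p ⬝ᵥ x - k : ℤ) : ℝ) := by exact_mod_cast hk
      _ = _ := by push_cast; rfl
  · obtain ⟨m, hm⟩ := WithTop.ne_top_iff_exists.1 htop
    have hg := isGreatest_of_discreteConjugate_eq hf hm.symm
    rw [← hm, toEReal_coe]
    apply le_antisymm
    · refine iSup_le fun x => ?_
      by_cases hx : f x = ⊤
      · simp [hx]
      · obtain ⟨k, hk⟩ := WithTop.ne_top_iff_exists.1 hx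
        rw [← hk, toEReal_coe, ← EReal.coe_sub, EReal.coe_le_coe_iff]
        exact_mod_cast hg.2 ⟨x, k, hk.symm, rfl⟩
    · obtain ⟨x, k, hx, hk⟩ := hg.1
      refine le_trans (le_of_eq ?_) (le_iSup _ x)
      rw [hx, toEReal_coe, ← EReal.coe_sub, ← hk]
      push_cast
      rfl

end Conjugate

/-! ### Translation-invariant submodular functions -/

section Exchange

variable {V : Type*}

/-- Invariance under translation by constant vectors. A submodular function with this property is
`L`-convex (with the constant `r = 0`). -/
def IsTranslationInvariant (F : (V → ℤ) → WithTop ℤ) : Prop :=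
  ∀ (x : V → ℤ) (c : ℤ), F (x + fun _ => c) = F x

theorem IsSubmodular.exists_coe {F : (V → ℤ) → WithTop ℤ} (hF : IsSubmodular F) {x y : V → ℤ}
    {k l : ℤ} (hx : F x = k) (hy : F y = l) :
    ∃ r s : ℤ, F (x ⊔ y) = r ∧ F (x ⊓ y) = s ∧ r + s ≤ k + l := by
  have h := hF x y
  rw [hx, hy, ← WithTop.coe_add] at h
  have hlt := lt_of_le_of_lt h (WithTop.coe_lt_top _)
  obtain ⟨hr, hs⟩ := WithTop.add_lt_top.1 hlt
  obtain ⟨r, hr⟩ := WithTop.ne_top_iff_exists.1 (ne_of_lt hr)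
  obtain ⟨s, hs⟩ := WithTop.ne_top_iff_exists.1 (ne_of_lt hs)
  refine ⟨r, s, hr.symm, hs.symm, ?_⟩
  rw [← hr, ← hs] at h
  exact_mod_cast h

variable [Fintype V]

theorem dotProduct_sup_add_dotProduct_inf (p x y : V → ℤ) :
    p ⬝ᵥ (x ⊔ y) + p ⬝ᵥ (x ⊓ y) = p ⬝ᵥ x + p ⬝ᵥ y := by
  rw [← dotProduct_add, ← dotProduct_add]
  congr 1
  funext i
  exact max_add_min (x i) (y i)

theorem dotProduct_const_of_sum_eq_zero {p : V → ℤ} (hp : ∑ i, p i = 0) (c : ℤ) :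
    p ⬝ᵥ (fun _ => c) = 0 := by
  simp [dotProduct, ← Finset.sum_mul, hp]

/-- The points at which the supremum `m` defining the conjugate of `F` at `p` is attained. -/
def maximizers (F : (V → ℤ) → WithTop ℤ) (p : V → ℤ) (m : ℤ) : Set (V → ℤ) :=
  {a | F a = ((p ⬝ᵥ a - m : ℤ) : WithTop ℤ)}

theorem sup_inf_mem_maximizers {F : (V → ℤ) → WithTop ℤ} (hF : IsSubmodular F) {p : V → ℤ} {m : ℤ}
    (hm : ∀ (x : V → ℤ) (k : ℤ), F x = k → p ⬝ᵥ x - k ≤ m) {a b : V → ℤ}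
    (ha : a ∈ maximizers F p m) (hb : b ∈ maximizers F p m) :
    a ⊔ b ∈ maximizers F p m ∧ a ⊓ b ∈ maximizers F p m := by
  obtain ⟨r, s, hr, hs, hrs⟩ := hF.exists_coe ha hb
  have h1 := hm _ _ hr
  have h2 := hm _ _ hs
  have h3 := dotProduct_sup_add_dotProduct_inf p a b
  constructor
  · rw [maximizers, Set.mem_ofPred_eq, hr, WithTop.coe_inj]; linarith
  · rw [maximizers, Set.mem_ofPred_eq, hs, WithTop.coe_inj]; linarith

theorem add_const_mem_maximizers {F : (V → ℤ) → WithTop ℤ} (hT : IsTranslationInvariant F)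
    {p : V → ℤ} (hp : ∑ i, p i = 0) {m : ℤ} {a : V → ℤ} (ha : a ∈ maximizers F p m) (c : ℤ) :
    (a + fun _ => c) ∈ maximizers F p m := by
  rw [maximizers, Set.mem_ofPred_eq, hT, dotProduct_add, dotProduct_const_of_sum_eq_zero hp, add_zero]
  exact ha

theorem exists_mem_maximizers {F : (V → ℤ) → WithTop ℤ} {p : V → ℤ} {m : ℤ}
    (hm : IsGreatest (conjugateValues F p) m) : ∃ a, a ∈ maximizers F p m := by
  obtain ⟨a, k, ha, hk⟩ := hm.1
  refine ⟨a, ?_⟩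
  rw [maximizers, Set.mem_ofPred_eq, ha, WithTop.coe_inj]; linarith

variable [DecidableEq V]

/-- Along the directions `e_v - e_u` a unit step of the conjugate is governed by the maximizers at
the starting point: if `a v - a u ≤ c` on all of them, the conjugate grows by at most `c`. -/
theorem dotProduct_exchange_sub_le {F : (V → ℤ) → WithTop ℤ} (hF : IsSubmodular F)
    (hT : IsTranslationInvariant F) {p : V → ℤ} (hp : ∑ i, p i = 0) {m : ℤ}
    (hm : IsGreatest (conjugateValues F p) m) {u v : V} {c : ℤ}
    (hc : ∀ a ∈ maximizers F p m, a v - a u ≤ c) {x : V → ℤ} {k : ℤ} (hx : F x = k) :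
    (p - Pi.single u 1 + Pi.single v 1) ⬝ᵥ x - k ≤ m + c := by
  have hm' : ∀ (x : V → ℤ) (k : ℤ), F x = k → p ⬝ᵥ x - k ≤ m := fun x k h => hm.2 ⟨x, k, h, rfl⟩
  have hdot : ∀ x : V → ℤ,
      (p - Pi.single u 1 + Pi.single v 1) ⬝ᵥ x = p ⬝ᵥ x + (x v - x u) := by
    intro x
    simp [add_dotProduct, sub_dotProduct]; ring
  obtain ⟨a₀, ha₀⟩ := exists_mem_maximizers hm
  obtain ⟨t, ⟨a, ha, rfl⟩, hmax⟩ := Int.exists_greatest_of_bdd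
    (P := fun t => ∃ a ∈ maximizers F p m, a v - a u = t)
    ⟨c, by rintro _ ⟨a, ha, rfl⟩; exact hc a ha⟩ ⟨_, a₀, ha₀, rfl⟩
  have hac := hc a ha
  -- Induction on the excess of `x v - x u` over `c`.
  obtain ⟨d, hd⟩ : ∃ d : ℕ, x v - x u - c ≤ d := ⟨(x v - x u - c).toNat, Int.self_le_toNat _⟩
  induction d generalizing x k with
  | zero =>
    have := hm' x k hx
    rw [hdot]
    push_cast at hd
    linarith
  | succ d ih =>
    rcases le_or_gt (x v - x u) c with hle | hlt
    · have := hm' x k hx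
      rw [hdot]
      linarith
    · -- The translate of `a` one below `x` at `v`: the join with `x` has a larger difference than
      -- any maximizer, while the meet has difference one less than `x`.
      set b : V → ℤ := a + fun _ => x v - 1 - a v with hb
      have hbm : b ∈ maximizers F p m := add_const_mem_maximizers hT hp ha _
      have hbv : b v = x v - 1 := by simp [hb]
      have hbu : b u = a u + (x v - 1 - a v) := by simp [hb]
      obtain ⟨r, s, hr, hs, hrs⟩ := hF.exists_coe hx hbm
      have hsupv : (x ⊔ b) v = x v := by rw [Pi.sup_apply, hbv]; exact max_eq_left (by omega)
      have hsupu : (x ⊔ b) u = b u := by rw [Pi.sup_apply]; exact max_eq_right (by omega)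
      have hinfv : (x ⊓ b) v = x v - 1 := by rw [Pi.inf_apply, hbv]; exact min_eq_right (by omega)
      have hinfu : (x ⊓ b) u = x u := by rw [Pi.inf_apply]; exact min_eq_left (by omega)
      have h1 : p ⬝ᵥ (x ⊔ b) - r ≤ m - 1 := by
        have hle := hm' _ _ hr
        rcases hle.lt_or_eq with h | h
        · omega
        · have hmem : x ⊔ b ∈ maximizers F p m := by
            rw [maximizers, Set.mem_ofPred_eq, hr, WithTop.coe_inj]; linarith
          have := hmax _ ⟨_, hmem, rfl⟩
          omega
      have h2 := ih hs (by push_cast at hd; rw [hinfv, hinfu]; linarith)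
      have h3 := dotProduct_sup_add_dotProduct_inf p x b
      rw [hdot, hinfv, hinfu] at h2
      rw [hdot]
      linarith

/-- If the exchange inequality fails for the pair `u, v`, then some maximizers at `p` and at `q`
differ accordingly. -/
theorem exists_maximizers_of_not_exchange {F : (V → ℤ) → WithTop ℤ} (hF : IsSubmodular F)
    (hT : IsTranslationInvariant F) (hdom : (dom F).Nonempty) {p q : V → ℤ}
    (hp : ∑ i, p i = 0) (hq : ∑ i, q i = 0) {m l : ℤ}
    (hm : IsGreatest (conjugateValues F p) m) (hl : IsGreatest (conjugateValues F q) l) {u v : V}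
    (hne : ¬ discreteConjugate F (p - Pi.single u 1 + Pi.single v 1) +
      discreteConjugate F (q + Pi.single u 1 - Pi.single v 1) ≤ (m : WithTop ℤ) + l) :
    ∃ a ∈ maximizers F p m, ∃ b ∈ maximizers F q l, b v - b u < a v - a u := by
  by_contra! hcon
  obtain ⟨a₀, ha₀⟩ := exists_mem_maximizers hm
  obtain ⟨b₀, hb₀⟩ := exists_mem_maximizers hl
  obtain ⟨c, ⟨a, ha, rfl⟩, hmax⟩ := Int.exists_greatest_of_bdd
    (P := fun t => ∃ a ∈ maximizers F p m, a v - a u = t)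
    ⟨b₀ v - b₀ u, by rintro _ ⟨a, ha, rfl⟩; exact hcon a ha b₀ hb₀⟩ ⟨_, a₀, ha₀, rfl⟩
  apply hne
  have h1 : discreteConjugate F (p - Pi.single u 1 + Pi.single v 1) ≤ (m + (a v - a u) : ℤ) :=
    (discreteConjugate_le_iff hdom).2 fun x k hx =>
      dotProduct_exchange_sub_le hF hT hp hm (fun a' ha' => hmax _ ⟨a', ha', rfl⟩) hx
  have h2 : discreteConjugate F (q + Pi.single u 1 - Pi.single v 1) ≤ (l + -(a v - a u) : ℤ) := by
    rw [add_sub_right_comm]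
    exact (discreteConjugate_le_iff hdom).2 fun x k hx =>
      dotProduct_exchange_sub_le hF hT hq hl
        (fun b hb => by have := hcon a ha b hb; linarith) hx
  refine (add_le_add h1 h2).trans (le_of_eq ?_)
  rw [← WithTop.coe_add, ← WithTop.coe_add]
  congr 1
  ring

/-- The conjugate of a translation-invariant submodular function satisfies the exchange axiom of
`M`-convex functions on the hyperplane of vectors with coordinate sum zero. -/
theorem exists_exchange {F : (V → ℤ) → WithTop ℤ} (hF : IsSubmodular F)
    (hT : IsTranslationInvariant F) (hdom : (dom F).Nonempty) {p q : V → ℤ}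
    (hp : ∑ i, p i = 0) (hq : ∑ i, q i = 0) {u : V} (hu : q u < p u)
    (hpt : discreteConjugate F p ≠ ⊤) (hqt : discreteConjugate F q ≠ ⊤) :
    ∃ v, p v < q v ∧ discreteConjugate F (p - Pi.single u 1 + Pi.single v 1) +
      discreteConjugate F (q + Pi.single u 1 - Pi.single v 1) ≤
        discreteConjugate F p + discreteConjugate F q := by
  obtain ⟨m, hpm⟩ := WithTop.ne_top_iff_exists.1 hpt
  obtain ⟨l, hql⟩ := WithTop.ne_top_iff_exists.1 hqt
  have hm := isGreatest_of_discreteConjugate_eq hdom hpm.symm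
  have hl := isGreatest_of_discreteConjugate_eq hdom hql.symm
  have hm' : ∀ (x : V → ℤ) (k : ℤ), F x = k → p ⬝ᵥ x - k ≤ m := fun x k h => hm.2 ⟨x, k, h, rfl⟩
  have hl' : ∀ (x : V → ℤ) (k : ℤ), F x = k → q ⬝ᵥ x - k ≤ l := fun x k h => hl.2 ⟨x, k, h, rfl⟩
  rw [← hpm, ← hql]
  by_contra! hcon
  -- Joins of maximizers at `p` and meets of maximizers at `q` treat all `v` simultaneously.
  have key : ∀ T : Finset V, (∀ v ∈ T, p v < q v) →
      ∃ a ∈ maximizers F p m, ∃ b ∈ maximizers F q l, a u = 0 ∧ b u = 0 ∧ ∀ v ∈ T, b v < a v := by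
    intro T
    induction T using Finset.induction_on with
    | empty =>
      intro _
      obtain ⟨a, ha⟩ := exists_mem_maximizers hm
      obtain ⟨b, hb⟩ := exists_mem_maximizers hl
      exact ⟨_, add_const_mem_maximizers hT hp ha (-a u), _,
        add_const_mem_maximizers hT hq hb (-b u), by simp, by simp, by simp⟩
    | insert w T _ ih =>
      intro hTw
      obtain ⟨a, ha, b, hb, hau, hbu, hab⟩ := ih fun v hv => hTw v (Finset.mem_insert_of_mem hv)
      obtain ⟨a', ha', b', hb', hab'⟩ := exists_maximizers_of_not_exchange hF hT hdom hp hq hm hl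
        (not_le.2 (hcon w (hTw w (Finset.mem_insert_self w T))))
      refine ⟨_, (sup_inf_mem_maximizers hF hm' ha (add_const_mem_maximizers hT hp ha' (-a' u))).1,
        _, (sup_inf_mem_maximizers hF hl' hb (add_const_mem_maximizers hT hq hb' (-b' u))).2,
        by simp [hau], by simp [hbu], ?_⟩
      intro v hv
      simp only [Pi.sup_apply, Pi.inf_apply, Pi.add_apply]
      rcases Finset.mem_insert.1 hv with rfl | hv
      · exact lt_of_le_of_lt (min_le_right _ _) (lt_of_lt_of_le (by omega) (le_max_right _ _))
      · exact lt_of_le_of_lt (min_le_left _ _) (lt_of_lt_of_le (hab v hv) (le_max_left _ _))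
  obtain ⟨a, ha, b, hb, hau, hbu, hab⟩ := key (Finset.univ.filter fun v => p v < q v) (by simp)
  -- Submodularity at `a` and `b + 1` now forces `⟨p - q, (b + 1 - a)⁺⟩ ≤ 0`, where the positive part
  -- vanishes wherever `p < q` and equals `1` at `u`.
  have hb1 := add_const_mem_maximizers hT hq hb 1
  set b' : V → ℤ := b + fun _ => 1 with hb'
  obtain ⟨r, s, hr, hs, hrs⟩ := hF.exists_coe ha hb1
  have h1 := hm' _ _ hr
  have h2 := hl' _ _ hs
  have h3 := dotProduct_sup_add_dotProduct_inf q a b'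
  have h4 : (p - q) ⬝ᵥ (a ⊔ b' - a) ≤ 0 := by
    rw [dotProduct_sub, sub_dotProduct, sub_dotProduct]
    linarith
  have hterm : ∀ v, 0 ≤ (p - q) v * (a ⊔ b' - a) v := by
    intro v
    rcases lt_or_ge (p v) (q v) with h | h
    · have := hab v (by simp [h])
      have h0 : (a ⊔ b' - a) v = 0 := by
        simp only [Pi.sub_apply, Pi.sup_apply, hb', Pi.add_apply]
        rw [max_eq_left (by omega), sub_self]
      rw [h0, mul_zero]
    · refine mul_nonneg (sub_nonneg.2 h) (sub_nonneg.2 (le_max_left _ _))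
  have hupos : 0 < (p - q) u * (a ⊔ b' - a) u := by
    refine mul_pos (sub_pos.2 hu) ?_
    simp [hb', hau, hbu]
  exact absurd h4 (not_le.2 (Finset.sum_pos' (fun v _ => hterm v) ⟨u, Finset.mem_univ u, hupos⟩))

end Exchange

/-! ### Integral subgradients -/

section Subgradient

variable {V : Type*} [Fintype V]

/-- A translation-invariant submodular function that is finite at the origin has an integral
subgradient on the unit cube. It is found as a maximal vector below the submodular set function
`S ↦ F (χ_S) - F 0`: by maximality every element lies in a tight set, and tight sets are closed
under union. -/
theorem exists_subgradient_unitCube [DecidableEq V] {F : (V → ℤ) → WithTop ℤ} (hF : IsSubmodular F)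
    (hT : IsTranslationInvariant F) {k₀ : ℤ} (h0 : F 0 = k₀) :
    ∃ p : V → ℤ, ∑ i, p i = 0 ∧
      ∀ (x : V → ℤ) (k : ℤ), 0 ≤ x → x ≤ 1 → F x = k → p ⬝ᵥ x ≤ k - k₀ := by
  let P : (V → ℤ) → Prop := fun p =>
    ∀ (x : V → ℤ) (k : ℤ), 0 ≤ x → x ≤ 1 → F x = k → p ⬝ᵥ x ≤ k - k₀
  have hF1 : F 1 = k₀ := by
    have h := hT 0 1
    rw [zero_add, h0] at h
    exact h
  have hne : ∃ p, P p := by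
    obtain ⟨C, hC⟩ := ((Set.finite_Icc (0 : V → ℤ) 1).image
      fun x => k₀ - (F x).untopD 0).bddAbove
    refine ⟨fun _ => -max C 0, fun x k hx0 hx1 hx => ?_⟩
    have hCx : k₀ - k ≤ C := by
      have := hC ⟨x, ⟨hx0, hx1⟩, rfl⟩
      simpa [hx] using this
    rcases eq_or_ne x 0 with rfl | hxne
    · rw [h0, WithTop.coe_inj] at hx
      simp [hx]
    · have hsum : 1 ≤ ∑ i, x i := by
        obtain ⟨i, hi⟩ := Function.ne_iff.1 hxne
        have h1 : 1 ≤ x i := lt_of_le_of_ne (hx0 i) (Ne.symm hi)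
        exact h1.trans (Finset.single_le_sum (fun j _ => hx0 j) (Finset.mem_univ i))
      have hdot : (fun _ : V => -max C 0) ⬝ᵥ x = -(max C 0 * ∑ i, x i) := by
        simp [dotProduct, Finset.mul_sum]
      rw [hdot]
      nlinarith [le_max_left C 0, le_max_right C 0]
  have hbd : ∀ p, P p → ∑ i, p i ≤ 0 := by
    intro p hp
    have := hp 1 k₀ zero_le_one le_rfl hF1
    simpa [dotProduct] using this
  obtain ⟨p₀, hp₀⟩ := hne
  obtain ⟨t, ⟨p, hp, rfl⟩, hmax⟩ := Int.exists_greatest_of_bdd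
    (P := fun t => ∃ p, P p ∧ ∑ i, p i = t)
    ⟨0, by rintro _ ⟨p, hp, rfl⟩; exact hbd p hp⟩ ⟨_, p₀, hp₀, rfl⟩
  refine ⟨p, ?_, hp⟩
  have htight : ∀ v, ∃ x : V → ℤ, 0 ≤ x ∧ x ≤ 1 ∧ x v = 1 ∧
      F x = ((p ⬝ᵥ x + k₀ : ℤ) : WithTop ℤ) := by
    intro v
    have hnot : ¬ P (p + Pi.single v 1) := by
      intro h
      have := hmax _ ⟨_, h, rfl⟩
      simp [Finset.sum_add_distrib] at this
    simp only [P] at hnot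
    push Not at hnot
    obtain ⟨x, k, hx0, hx1, hx, hlt⟩ := hnot
    have hle := hp x k hx0 hx1 hx
    rw [add_dotProduct, single_dotProduct, one_mul] at hlt
    have hxv : x v ≤ 1 := hx1 v
    refine ⟨x, hx0, hx1, by omega, ?_⟩
    rw [hx, WithTop.coe_inj]
    omega
  have key : ∀ T : Finset V, ∃ x : V → ℤ, 0 ≤ x ∧ x ≤ 1 ∧ (∀ v ∈ T, x v = 1) ∧
      F x = ((p ⬝ᵥ x + k₀ : ℤ) : WithTop ℤ) := by
    intro T
    induction T using Finset.induction_on with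
    | empty => exact ⟨0, le_rfl, zero_le_one, by simp, by simp [h0]⟩
    | insert w T _ ih =>
      obtain ⟨x, hx0, hx1, hxT, hx⟩ := ih
      obtain ⟨y, hy0, hy1, hyw, hy⟩ := htight w
      refine ⟨x ⊔ y, hx0.trans le_sup_left, sup_le hx1 hy1, ?_, ?_⟩
      · intro v hv
        refine le_antisymm (sup_le (hx1 v) (hy1 v)) ?_
        rcases Finset.mem_insert.1 hv with rfl | hv
        · exact hyw.symm.le.trans le_sup_right
        · exact (hxT v hv).symm.le.trans le_sup_left
      · obtain ⟨r, s, hr, hs, hrs⟩ := hF.exists_coe hx hy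
        have h1 := hp _ _ (hx0.trans le_sup_left) (sup_le hx1 hy1) hr
        have h2 := hp _ _ (le_inf hx0 hy0) (inf_le_left.trans hx1) hs
        have h3 := dotProduct_sup_add_dotProduct_inf p x y
        rw [hr, WithTop.coe_inj]
        linarith
  obtain ⟨x, -, -, hx1, hx⟩ := key Finset.univ
  obtain rfl : x = 1 := funext fun v => hx1 v (Finset.mem_univ v)
  rw [hF1, WithTop.coe_inj] at hx
  simpa [dotProduct] using hx

/-- A subgradient on the unit cube is a global one: submodularity at `x` and the all-ones vector
peels off the level sets of `x` one at a time. -/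
theorem dotProduct_le_of_unitCube {F : (V → ℤ) → WithTop ℤ} (hF : IsSubmodular F)
    (hT : IsTranslationInvariant F) {k₀ : ℤ} (h0 : F 0 = k₀) {p : V → ℤ} (hp : ∑ i, p i = 0)
    (hcube : ∀ (x : V → ℤ) (k : ℤ), 0 ≤ x → x ≤ 1 → F x = k → p ⬝ᵥ x ≤ k - k₀)
    {x : V → ℤ} {k : ℤ} (hx : F x = k) : p ⬝ᵥ x ≤ k - k₀ := by
  have hF1 : F 1 = k₀ := by
    have h := hT 0 1
    rw [zero_add, h0] at h
    exact h
  have hp1 : p ⬝ᵥ 1 = 0 := dotProduct_const_of_sum_eq_zero hp 1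
  have hnonneg : ∀ (d : ℕ) (x : V → ℤ) (k : ℤ), 0 ≤ x → (∀ v, x v ≤ d) → F x = k →
      p ⬝ᵥ x ≤ k - k₀ := by
    intro d
    induction d with
    | zero => exact fun x k h0x hxd hx => hcube x k h0x (fun v => (hxd v).trans zero_le_one) hx
    | succ d ih =>
      intro x k h0x hxd hx
      obtain ⟨r, s, hr, hs, hrs⟩ := hF.exists_coe hx hF1
      have hr' : F ((x ⊔ 1) + fun _ => (-1)) = r := by rw [hT, hr]
      have h1 := ih _ r (fun v => by simp [Pi.sup_apply])
        (fun v => by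
          have := hxd v
          push_cast at this
          simp only [Pi.add_apply, Pi.sup_apply, Pi.one_apply]
          have : max (x v) 1 ≤ (d : ℤ) + 1 := max_le this (by omega)
          omega) hr'
      have h2 := hcube (x ⊓ 1) s (le_inf h0x zero_le_one) inf_le_right hs
      rw [dotProduct_add, dotProduct_const_of_sum_eq_zero hp] at h1
      have h3 := dotProduct_sup_add_dotProduct_inf p x 1
      linarith
  obtain ⟨C, hC⟩ := (Set.finite_range fun v => |x v|).bddAbove
  have hC' : ∀ v, |x v| ≤ C := fun v => hC ⟨v, rfl⟩
  have h1 := hnonneg (2 * C).toNat (x + fun _ => C) k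
    (fun v => by
      have := neg_abs_le (x v)
      have := hC' v
      simp only [Pi.add_apply, Pi.zero_apply]
      omega)
    (fun v => by
      have := le_abs_self (x v)
      have := hC' v
      simp only [Pi.add_apply]
      omega)
    (by rw [hT, hx])
  rwa [dotProduct_add, dotProduct_const_of_sum_eq_zero hp, add_zero] at h1

theorem exists_discreteConjugate_lt_top [DecidableEq V] {F : (V → ℤ) → WithTop ℤ} (hF : IsSubmodular F)
    (hT : IsTranslationInvariant F) (hdom : (dom F).Nonempty) :
    ∃ p : V → ℤ, ∑ i, p i = 0 ∧ discreteConjugate F p < ⊤ := by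
  obtain ⟨x₀, hx₀⟩ := id hdom
  obtain ⟨k₀, hk₀⟩ := WithTop.ne_top_iff_exists.1 (ne_of_lt (show F x₀ < ⊤ from hx₀))
  let G : (V → ℤ) → WithTop ℤ := fun x => F (x + x₀)
  have hG : IsSubmodular G := by
    intro x y
    simp only [G]
    rw [sup_add, inf_add]
    exact hF _ _
  have hGT : IsTranslationInvariant G := by
    intro x c
    simp only [G]
    rw [add_right_comm, hT]
  have hG0 : G 0 = k₀ := by simp [G, hk₀]
  obtain ⟨p, hp, hcube⟩ := exists_subgradient_unitCube hG hGT hG0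
  refine ⟨p, hp, lt_of_le_of_lt ?_ (WithTop.coe_lt_top (p ⬝ᵥ x₀ - k₀))⟩
  refine (discreteConjugate_le_iff hdom).2 fun x k hx => ?_
  have h := dotProduct_le_of_unitCube hG hGT hG0 hp hcube (x := x - x₀) (k := k) (by simp [G, hx])
  rw [dotProduct_sub] at h
  linarith

end Subgradient

/-! ### Homogeneous coordinates and the bidiagonal matrix -/

/-- The vector `(-∑ qᵢ, q₁, …, qₙ)` with coordinate sum zero. -/
def homogenize {n : ℕ} (q : Fin n → ℤ) : Fin (n + 1) → ℤ :=
  Fin.cons (-∑ i, q i) q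

theorem sum_homogenize {n : ℕ} (q : Fin n → ℤ) : ∑ i, homogenize q i = 0 := by
  simp [homogenize, Fin.sum_univ_succ]

theorem homogenize_add {n : ℕ} (q r : Fin n → ℤ) :
    homogenize (q + r) = homogenize q + homogenize r := by
  funext i
  refine Fin.cases ?_ (fun j => ?_) i
  · simp [homogenize, Finset.sum_add_distrib]; ring
  · simp [homogenize]

theorem homogenize_sub {n : ℕ} (q r : Fin n → ℤ) :
    homogenize (q - r) = homogenize q - homogenize r := by
  rw [eq_sub_iff_add_eq, ← homogenize_add, sub_add_cancel]

theorem homogenize_single {n : ℕ} (i : Fin n) :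
    homogenize (Pi.single i 1) = Pi.single i.succ 1 - Pi.single 0 1 := by
  funext k
  refine Fin.cases ?_ (fun j => ?_) k
  · simp [homogenize]
  · simp [homogenize, Pi.single_apply]

theorem homogenize_tail {n : ℕ} {p : Fin (n + 1) → ℤ} (hp : ∑ i, p i = 0) :
    homogenize (Fin.tail p) = p := by
  rw [Fin.sum_univ_succ] at hp
  funext k
  refine Fin.cases ?_ (fun j => ?_) k
  · simp [homogenize, Fin.tail]; linarith
  · simp [homogenize, Fin.tail]

theorem isUnit_det_bidiagonal (n : ℕ) : IsUnit (bidiagonal n).det := by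
  have h : (bidiagonal n).BlockTriangular OrderDual.toDual := by
    intro i j hij
    have hij' : i < j := hij
    have hne : i ≠ j := hij'.ne
    have : ¬ (i : ℕ) = (j : ℕ) + 1 := by
      have : (i : ℕ) < j := hij'
      omega
    simp [bidiagonal, hne, this]
  rw [Matrix.det_of_isLowerTriangular _ h]
  simp [bidiagonal]

theorem bidiagonal_mulVec_tail {n : ℕ} (z : Fin (n + 1) → ℤ) :
    bidiagonal n *ᵥ (fun i => z i.succ - z 0) = fun i => z i.succ - z i.castSucc := by
  funext i
  have hrow : ∀ j, bidiagonal n i j =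
      (if i = j then 1 else 0) - (if (i : ℕ) = (j : ℕ) + 1 then 1 else 0) := by
    intro j
    simp only [bidiagonal, Matrix.of_apply]
    split_ifs with h1 h2 <;> simp_all
  simp only [mulVec, dotProduct, hrow, sub_mul, Finset.sum_sub_distrib, ite_mul, one_mul, zero_mul,
    Finset.sum_ite_eq, Finset.mem_univ, if_true]
  cases n with
  | zero => exact i.elim0
  | succ n =>
    refine Fin.cases ?_ (fun k => ?_) i
    · simp
    · rw [Finset.sum_eq_single k.castSucc]
      · simp
      · intro j _ hj
        rw [if_neg]
        intro h
        apply hj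
        ext
        simp at h ⊢
        omega
      · simp

/-- The adjoint of the difference map sends `p` to the homogenization of `Dᵀ p`; this is where the
bidiagonal matrix enters. -/
theorem dotProduct_difference {n : ℕ} (p : Fin n → ℤ) (z : Fin (n + 1) → ℤ) :
    p ⬝ᵥ (fun i => z i.succ - z i.castSucc) =
      homogenize ((bidiagonal n).transpose *ᵥ p) ⬝ᵥ z := by
  rw [← bidiagonal_mulVec_tail, dotProduct_mulVec, ← mulVec_transpose]
  simp [homogenize, dotProduct, Fin.sum_univ_succ, mul_sub, Finset.sum_sub_distrib, Finset.sum_mul]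
  ring

theorem difference_surjective (n : ℕ) :
    Function.Surjective fun (z : Fin (n + 1) → ℤ) (i : Fin n) => z i.succ - z i.castSucc := by
  intro x
  refine ⟨fun i => Fin.partialSum x i, ?_⟩
  funext i
  simp [Fin.partialSum_succ]

theorem integralConjugate_eq_differenceLift {n : ℕ} (f : (Fin n → ℤ) → WithTop ℤ) (p : Fin n → ℤ) :
    integralConjugate f p =
      integralConjugate (differenceLift f) (homogenize ((bidiagonal n).transpose *ᵥ p)) := by
  unfold integralConjugate
  rw [← (difference_surjective n).iSup_comp]
  refine iSup_congr fun z => ?_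
  rw [dotProduct_difference]
  rfl

theorem isTranslationInvariant_differenceLift {n : ℕ} (f : (Fin n → ℤ) → WithTop ℤ) :
    IsTranslationInvariant (differenceLift f) := by
  intro x c
  simp [differenceLift]

/-- Restricting the `M`-convex conjugate to homogeneous coordinates gives an `M♮`-convex function;
an exchange with the extra coordinate becomes the alternative without `j`. -/
theorem isMNaturalConvex_discreteConjugate_homogenize {n : ℕ} {F : (Fin (n + 1) → ℤ) → WithTop ℤ}
    (hF : IsSubmodular F) (hT : IsTranslationInvariant F) (hdom : (dom F).Nonempty) :
    IsMNaturalConvex fun q : Fin n → ℤ => discreteConjugate F (homogenize q) := by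
  constructor
  · obtain ⟨p, hp, hlt⟩ := exists_discreteConjugate_lt_top hF hT hdom
    refine ⟨Fin.tail p, ?_⟩
    simpa [dom, homogenize_tail hp] using hlt
  · intro x y i hi
    by_cases hx : discreteConjugate F (homogenize x) = ⊤
    · left; simp [hx]
    by_cases hy : discreteConjugate F (homogenize y) = ⊤
    · left; simp [hy]
    obtain ⟨v, hv, hle⟩ := exists_exchange hF hT hdom (sum_homogenize x) (sum_homogenize y)
      (u := i.succ) (by simpa [homogenize] using hi) hx hy
    induction v using Fin.cases with
    | zero =>
      left
      convert hle using 3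
      · rw [homogenize_sub, homogenize_single]; abel
      · rw [homogenize_add, homogenize_single]; abel
    | succ j =>
      right
      refine ⟨j, by simpa [homogenize] using hv, ?_⟩
      convert hle using 3
      · rw [homogenize_add, homogenize_sub, homogenize_single, homogenize_single]; abel
      · rw [homogenize_sub, homogenize_add, homogenize_single, homogenize_single]; abel

end DiscreteConvex

theorem mainTheorem2 (n : ℕ) (f : (Fin n → ℤ) → WithTop ℤ)
    (hf : DiscreteConvex.IsMultimodular f) :
    IsUnit (DiscreteConvex.bidiagonal n).det ∧
      ∃ h : (Fin n → ℤ) → WithTop ℤ, DiscreteConvex.IsMNaturalConvex h ∧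
        ∀ p : Fin n → ℤ,
          DiscreteConvex.integralConjugate f p =
            DiscreteConvex.toEReal (h ((DiscreteConvex.bidiagonal n).transpose.mulVec p)) := by
  open DiscreteConvex in
  have hdom : (dom (differenceLift f)).Nonempty := by
    obtain ⟨x, hx⟩ := hf.1
    obtain ⟨z, rfl⟩ := difference_surjective n x
    exact ⟨z, hx⟩
  refine ⟨DiscreteConvex.isUnit_det_bidiagonal n, _,
    DiscreteConvex.isMNaturalConvex_discreteConjugate_homogenize hf.2
      (DiscreteConvex.isTranslationInvariant_differenceLift f) hdom, fun p => ?_⟩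
  rw [DiscreteConvex.integralConjugate_eq_differenceLift,
    DiscreteConvex.integralConjugate_eq_toEReal hdom]
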